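/- Let $\mathbb{N}=\{1,2,3,\dots\}$ and let $\|\cdot\|$ denote the Euclidean norm on every $\mathbb{R}^k$ and on $(\mathbb{R}^d)^N\cong\mathbb{R}^{dN}$. An artificial neural network (ANN) with input dimension $l_0\in\mathbb{N}$ and output dimension $l_L\in\mathbb{N}$ is a tuple $\Phi=((W_1,B_1),\dots,(W_L,B_L))$ with $L\in\mathbb{N}$, $l_0,\dots,l_L\in\mathbb{N}$, $W_k\in\mathbb{R}^{l_k\times l_{k-1}}$ and $B_k\in\mathbb{R}^{l_k}$. Its number of parameters is $\mathcal{P}(\Phi)=\sum_{k=1}^L l_k(l_{k-1}+1)$. Let $a\colon\mathbb{R}\to\mathbb{R}$, $a(x)=\max\{x,0\}$. The realization $\mathcal{R}(\Phi)\colon\mathbb{R}^{l_0}\to\mathbb{R}^{l_L}$ is given by $(\mathcal{R}(\Phi))(x_0)=W_Lx_{L-1}+B_L$, where $x_k$, $0<k<L$, is obtained from $W_kx_{k-1}+B_k$ by applying $a$ to each coordinate. Let $\mathfrak{c},T,\mathfrak{d}\in(0,\infty)$. For every $d\in\mathbb{N}$ let $\Phi_d$ be an ANN with input and output dimension $d$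 such that $\|(\mathcal{R}(\Phi_d))(x)\|\le\mathfrak{c}(1+\|x\|)$ for all $x\in\mathbb{R}^d$ and $\mathcal{P}(\Phi_d)\le\mathfrak{c}\,d^{\mathfrak{d}}$. For $d,N\in\mathbb{N}$ let $Y^{d,N}\colon[0,T]\times\mathbb{R}^d\times(\mathbb{R}^d)^N\to\mathbb{R}^d$ be the function which satisfies for all $n\in\{0,\dots,N-1\}$, $t\in[\frac{nT}{N},\frac{(n+1)T}{N}]$, $x\in\mathbb{R}^d$, $y=(y_1,\dots,y_N)\in(\mathbb{R}^d)^N$ that $Y^{d,N}_{0,x,y}=x$ and $$Y^{d,N}_{t,x,y}=Y^{d,N}_{\frac{nT}{N},x,y}+\Big(\frac{tN}{T}-n\Big)\Big[\frac{T}{N}(\mathcal{R}(\Phi_d))\big(Y^{d,N}_{\frac{nT}{N},x,y}\big)+y_{n+1}\Big].$$ Then there exist $C\in\mathbb{R}$ and ANNs $\Psi_{\varepsilon,d,N,y}$ with input dimension $d+1$ and output dimension $d$, for $\varepsilon\in(0,1]$, $d,N\in\mathbb{N}$, $y\in(\mathbb{R}^d)^N$, such that for all $\varepsilon\in(0,1]$,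 $d,N\in\mathbb{N}$: 1. for all $y\in(\mathbb{R}^d)^N$, $\mathcal{R}(\Psi_{\varepsilon,d,N,y})\in C(\mathbb{R}^{d+1},\mathbb{R}^d)$; 2. for all $t\in[0,T]$, $x\in\mathbb{R}^d$, $y\in(\mathbb{R}^d)^N$, $$\|Y^{d,N}_{t,x,y}-(\mathcal{R}(\Psi_{\varepsilon,d,N,y}))(t,x)\|\le C\,d^{1/2}N^{3/2}\,\varepsilon\,(1+\|x\|^3+\|y\|^3);$$ 3. for all $t\in[0,T]$, $x\in\mathbb{R}^d$, $y\in(\mathbb{R}^d)^N$, $$\|(\mathcal{R}(\Psi_{\varepsilon,d,N,y}))(t,x)\|\le C\,d^{1/2}N\,(1+\|x\|^2+\|y\|^2);$$ 4. for all $y\in(\mathbb{R}^d)^N$, $$\mathcal{P}(\Psi_{\varepsilon,d,N,y})\le C\,d^{16+8\mathfrak{d}}N^6\,(1+|\ln\varepsilon|^2);$$ 5. for all $t\in[0,T]$, $x\in\mathbb{R}^d$, the map $(\mathbb{R}^d)^N\ni y\mapsto(\mathcal{R}(\Psi_{\varepsilon,d,N,y}))(t,x)\in\mathbb{R}^d$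 is continuous; 6. for all $n\in\{0,1,\dots,N\}$, $t\in[0,\frac{nT}{N}]$, $x\in\mathbb{R}^d$ and $y,z\in(\mathbb{R}^d)^N$ with $y_k=z_k$ for all $k\in\{1,\dots,n\}$, $$(\mathcal{R}(\Psi_{\varepsilon,d,N,y}))(t,x)=(\mathcal{R}(\Psi_{\varepsilon,d,N,z}))(t,x).$$ -/

import Mathlib

open scoped Matrix

noncomputable section

/-- `ℝ^d` with the Euclidean norm. -/
abbrev RVec (d : ℕ) : Type := EuclideanSpace ℝ (Fin d)

/-- `(ℝ^d)^N` with the Euclidean norm `‖y‖ = (∑ k, ‖y k‖²)^(1/2)`; the vector usually written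
`y_{k+1}` is `y k`, with `k : Fin N`. -/
abbrev RVecs (d N : ℕ) : Type := PiLp 2 (fun _ : Fin N => RVec d)

/-- The point `(t, x) ∈ ℝ^{d+1}` for `t ∈ ℝ` and `x ∈ ℝ^d`. -/
def timeSpace {d : ℕ} (t : ℝ) (x : RVec d) : RVec (d + 1) :=
  WithLp.toLp 2 (Fin.cons t x.ofLp : Fin (d + 1) → ℝ)

/-- The artificial neural networks with input dimension `m` and output dimension `n`, that is,
all finite nonempty lists `((W_1, B_1), …, (W_L, B_L))` of weight matrices
`W_k ∈ ℝ^{l_k × l_{k-1}}` and bias vectors `B_k ∈ ℝ^{l_k}` with `l_0 = m`, `l_L = n` and all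
`l_k ≥ 1`. The list is built from its last entry (`last`) by adding entries in front (`cons`);
in `cons` the dimension `k` is positive because it is the input dimension of the remaining
network. -/
inductive ANN : ℕ → ℕ → Type
  | last {m n : ℕ} (hm : 0 < m) (hn : 0 < n)
      (W : Matrix (Fin n) (Fin m) ℝ) (B : Fin n → ℝ) : ANN m n
  | cons {m k n : ℕ} (hm : 0 < m)
      (W : Matrix (Fin k) (Fin m) ℝ) (B : Fin k → ℝ) (Φ : ANN k n) : ANN m n

/-- The coordinatewise version `ℝ^d → ℝ^d` of a function `ψ : ℝ → ℝ`. -/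
def multidim (ψ : ℝ → ℝ) {d : ℕ} (x : RVec d) : RVec d :=
  WithLp.toLp 2 (fun i => ψ (x i))

/-- The affine map `x ↦ W x + B`. -/
def affineLayer {m n : ℕ} (W : Matrix (Fin n) (Fin m) ℝ) (B : Fin n → ℝ) (x : RVec m) :
    RVec n :=
  WithLp.toLp 2 (W *ᵥ x.ofLp + B)

namespace ANN

/-- The number of parameters `∑_{k=1}^L l_k (l_{k-1} + 1)`. -/
def paramCount : {m n : ℕ} → ANN m n → ℕ
  | m, n, .last _ _ _ _ => n * (m + 1)
  | m, _, .cons (k := k) _ _ _ Φ => k * (m + 1) + Φ.paramCount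

/-- The realization with activation function `a`: affine maps, with `a` applied coordinatewise
after every affine map except the last one. -/
def realize (a : ℝ → ℝ) : {m n : ℕ} → ANN m n → RVec m → RVec n
  | _, _, .last _ _ W B, x => affineLayer W B x
  | _, _, .cons _ W B Φ, x => Φ.realize a (multidim a (affineLayer W B x))

end ANN

end

noncomputable section

/-! With `τ = T / N`, the scheme has the closed form `Y_t = x + ∑ₖ clipUnit (t / τ - k) * vₖ`, where
`vₖ` is the full increment of step `k` (`eq_eulerInterp`): the ramp is 1 on completed steps and 0 on
steps not yet begun. For fixed `y` a ReLU network computes the grid points and the increments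
exactly, so only the products of ramp and increment need approximation. Their errors are never fed
back into the drift; they merely add up, and linear growth of the drift suffices, with no Lipschitz
bound.

Products come from squares by polarization, and squares from the iterated tent map, with error at
most `4⁻ᵐ` after `m` steps. The increment is first clipped to `[-1/ε, 1/ε]`, which costs at most `ε
v²`; thus `m` of order `|ln ε|` gives the error `ε (1 + v²)` (`abs_sub_prodApprox_le`). The total
error is governed by `∑ₖ ‖vₖ‖²`, which a discrete Gronwall argument bounds by a multiple of `1 +
‖x‖² + ‖y‖²`, uniformly in `d` and `N` (`sum_norm_eulerIncr_sq_le`). The approximate product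
vanishes exactly where the ramp does, so perturbations of later steps have no influence.

For the size, `isReluNet_eulerInterp` stacks the `N` steps with controlled depth and width, and
`ANN.exists_realize_eq` converts these into a parameter count. -/

/-- A function between real vector spaces that is realized by a ReLU network with `h` hidden
layers, each of them having between `1` and `w` neurons. -/
def IsReluNet (w : ℕ) : ℕ → ∀ {E F : Type} [AddCommGroup E] [Module ℝ E] [AddCommGroup F]
    [Module ℝ F], (E → F) → Prop
  | 0, E, F, _, _, _, _, f => ∃ A : E →ᵃ[ℝ] F, ∀ x, f x = A x
  | h + 1, E, F, _, _, _, _, f =>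
    ∃ (σ : Type) (_ : Fintype σ) (_ : Nonempty σ) (A : E →ᵃ[ℝ] (σ → ℝ)) (g : (σ → ℝ) → F),
      Fintype.card σ ≤ w ∧ IsReluNet w h g ∧ ∀ x, f x = g (fun i => max (A x i) 0)

/-! ### Composition and parallelization of ReLU networks -/

section Calculus

variable {E F G : Type} [AddCommGroup E] [Module ℝ E] [AddCommGroup F] [Module ℝ F]
  [AddCommGroup G] [Module ℝ G]

/-- A criterion for a function to be affine that is convenient for explicit formulas. -/
theorem exists_affineMap_of_add_smul {f : E → F} (hadd : ∀ x y, f (x + y) = f x + f y - f 0)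
    (hsmul : ∀ (c : ℝ) x, f (c • x) = c • f x + (1 - c) • f 0) :
    ∃ A : E →ᵃ[ℝ] F, ∀ x, f x = A x := by
  let L : E →ₗ[ℝ] F :=
    { toFun := fun x => f x - f 0
      map_add' := fun x y => by rw [hadd]; abel
      map_smul' := fun c x => by
        rw [hsmul, RingHom.id_apply, smul_sub, sub_smul, one_smul]; abel }
  exact ⟨L.toAffineMap + AffineMap.const ℝ E (f 0), fun x => by simp [L]⟩

namespace IsReluNet

variable {w w' h h' : ℕ} {f : E → F} {g : F → G}

theorem of_add_smul (hadd : ∀ x y, f (x + y) = f x + f y - f 0)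
    (hsmul : ∀ (c : ℝ) x, f (c • x) = c • f x + (1 - c) • f 0) : IsReluNet w 0 f :=
  exists_affineMap_of_add_smul hadd hsmul

theorem congr {f' : E → F} (hf : IsReluNet w h f) (hff' : ∀ x, f' x = f x) :
    IsReluNet w h f' := by
  rwa [funext hff']

theorem mono (hf : IsReluNet w h f) (hw : w ≤ w') : IsReluNet w' h f := by
  induction h generalizing E with
  | zero => exact hf
  | succ h ih =>
    obtain ⟨σ, i₁, i₂, A, g, hσ, hg, hfg⟩ := hf
    exact ⟨σ, i₁, i₂, A, g, hσ.trans hw, ih hg, hfg⟩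

/-- Adjacent affine maps merge, so affine rearrangements between networks cost no layer and `comp`
simply adds depths. -/
theorem comp_affine (hg : IsReluNet w h g) (hf : IsReluNet w 0 f) :
    IsReluNet w h (fun x => g (f x)) := by
  obtain ⟨A, hA⟩ := hf
  cases h with
  | zero =>
    obtain ⟨B, hB⟩ := hg
    exact ⟨B.comp A, fun x => by simp [hA, hB]⟩
  | succ h =>
    obtain ⟨σ, i₁, i₂, B, k, hσ, hk, hgk⟩ := hg
    exact ⟨σ, i₁, i₂, B.comp A, k, hσ, hk, fun x => by simp [hA, hgk]⟩

theorem comp (hg : IsReluNet w h' g) (hf : IsReluNet w h f) :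
    IsReluNet w (h + h') (fun x => g (f x)) := by
  induction h generalizing E with
  | zero => simpa using hg.comp_affine hf
  | succ h ih =>
    obtain ⟨σ, i₁, i₂, A, k, hσ, hk, hfk⟩ := hf
    rw [Nat.add_right_comm]
    exact ⟨σ, i₁, i₂, A, fun x => g (k x), hσ, ih hk, fun x => congrArg g (hfk x)⟩

/-- One hidden layer between two affine maps. -/
theorem of_layer {σ : Type} [Fintype σ] [Nonempty σ] (hσ : Fintype.card σ ≤ w)
    {A : E → σ → ℝ} {B : (σ → ℝ) → F} (hA : IsReluNet w 0 A) (hB : IsReluNet w 0 B)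
    (hf : ∀ x, f x = B (fun i => max (A x i) 0)) : IsReluNet w 1 f := by
  obtain ⟨A, hA⟩ := hA
  exact ⟨σ, _, ‹_›, A, B, hσ, hB, fun x => by simp [hf, hA]⟩

/-- A network in parallel with the identity. -/
theorem prod_id {Z : Type} [AddCommGroup Z] [Module ℝ Z] [Module.Finite ℝ Z]
    (hf : IsReluNet w h f) :
    IsReluNet (w + 2 * Module.finrank ℝ Z) h (fun p : E × Z => (f p.1, p.2)) := by
  induction h generalizing E with
  | zero =>
    obtain ⟨A, hA⟩ := hf
    exact ⟨A.prodMap (AffineMap.id ℝ Z), fun x => by simp [hA]⟩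
  | succ h ih =>
    obtain ⟨σ, i₁, i₂, A, g, hσ, hg, hfg⟩ := hf
    obtain ⟨e⟩ : Nonempty (Z ≃ₗ[ℝ] (Fin (Module.finrank ℝ Z) → ℝ)) :=
      ⟨(Module.finBasis ℝ Z).equivFun⟩
    set n := Module.finrank ℝ Z
    -- Since `z = max z 0 - max (-z) 0`, each carried coordinate needs two neurons per layer.
    let A' : E × Z → (σ ⊕ (Fin n ⊕ Fin n) → ℝ) := fun p =>
      Sum.elim (A p.1) (Sum.elim (e p.2) (-e p.2))
    have hA' : ∃ B : E × Z →ᵃ[ℝ] (σ ⊕ (Fin n ⊕ Fin n) → ℝ), ∀ x, A' x = B x := by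
      have hA (x) : A x = A.linear x + A 0 := congrFun A.decomp x
      refine exists_affineMap_of_add_smul (fun x y => ?_) (fun c x => ?_)
      · ext (i | i | i)
        · simp [A', hA (x.1 + y.1), hA x.1, hA y.1]; ring
        · simp [A']
        · simp [A']; ring
      · ext (i | i | i)
        · simp [A', hA (c • x.1), hA x.1]; ring
        · simp [A']
        · simp [A']
    obtain ⟨B, hB⟩ := hA'
    refine ⟨σ ⊕ (Fin n ⊕ Fin n), inferInstance, inferInstance, B,
      fun u => (g (fun i => u (.inl i)),
        e.symm (fun i => u (.inr (.inl i)) - u (.inr (.inr i)))), ?_, ?_, ?_⟩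
    · simp; omega
    · refine (ih hg).comp_affine (f := fun u : σ ⊕ (Fin n ⊕ Fin n) → ℝ => (fun i => u (.inl i),
        e.symm (fun i => u (.inr (.inl i)) - u (.inr (.inr i))))) (of_add_smul ?_ ?_)
      · intro x y
        refine Prod.ext (by ext; simp) (e.injective ?_)
        ext i
        simp [map_add, map_sub]; ring
      · intro c x
        refine Prod.ext (by ext; simp) (e.injective ?_)
        ext i
        simp [map_add]; ring
    · rintro ⟨x, z⟩
      rw [← hB]
      refine Prod.ext (by simp [hfg, A']) (e.injective ?_)
      ext i
      simp only [A', Sum.elim_inr, Sum.elim_inl, Pi.neg_apply, LinearEquiv.apply_symm_apply]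
      rcases le_total 0 (e z i) with hz | hz
      · rw [max_eq_left hz, max_eq_right (by linarith)]; ring
      · rw [max_eq_right hz, max_eq_left (by linarith)]; ring

/-- Finitely many copies of a network in parallel. -/
theorem pi {κ : Type} [Fintype κ] [Nonempty κ] (hf : IsReluNet w h f) :
    IsReluNet (Fintype.card κ * w) h (fun (x : κ → E) i => f (x i)) := by
  induction h generalizing E with
  | zero =>
    obtain ⟨A, hA⟩ := hf
    exact ⟨AffineMap.pi fun i => A.comp (LinearMap.proj i : (κ → E) →ₗ[ℝ] E).toAffineMap,
      fun x => by ext; simp [hA]⟩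
  | succ h ih =>
    obtain ⟨σ, i₁, i₂, A, g, hσ, hg, hfg⟩ := hf
    refine ⟨κ × σ, inferInstance, inferInstance, AffineMap.pi fun p =>
      ((LinearMap.proj p.2 : (σ → ℝ) →ₗ[ℝ] ℝ).toAffineMap.comp A).comp
        (LinearMap.proj p.1 : (κ → E) →ₗ[ℝ] E).toAffineMap,
      fun u i => g (fun j => u (i, j)), ?_, ?_, ?_⟩
    · rw [Fintype.card_prod]
      exact Nat.mul_le_mul_left _ hσ
    · exact (ih hg).comp_affine (f := fun (u : κ × σ → ℝ) i j => u (i, j))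
        (of_add_smul (fun x y => by ext; simp) (fun c x => by ext; simp))
    · intro x
      ext i
      simp [hfg]

end IsReluNet

end Calculus

/-! ### Translation between `ANN` and `IsReluNet` -/

namespace ANN

theorem pos_left {m n : ℕ} (Φ : ANN m n) : 0 < m := by
  cases Φ <;> assumption

theorem isReluNet_affineLayer {m n w : ℕ} (W : Matrix (Fin n) (Fin m) ℝ) (B : Fin n → ℝ) :
    IsReluNet w 0 (affineLayer W B) := by
  refine .of_add_smul (fun x y => ?_) (fun c x => ?_)
  · ext i; simp [affineLayer, Matrix.mulVec_add]; ring
  · ext i; simp [affineLayer, Matrix.mulVec_smul]; ring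

theorem continuous_affineLayer {m n : ℕ} (W : Matrix (Fin n) (Fin m) ℝ) (B : Fin n → ℝ) :
    Continuous (affineLayer W B) := by
  unfold affineLayer
  fun_prop

theorem continuous_realize {a : ℝ → ℝ} (ha : Continuous a) {m n : ℕ} (Φ : ANN m n) :
    Continuous (Φ.realize a) := by
  induction Φ with
  | last hm hn W B => exact continuous_affineLayer W B
  | cons hm W B Φ ih =>
    refine ih.comp (Continuous.comp (g := multidim a) ?_ (continuous_affineLayer W B))
    unfold multidim
    fun_prop

/-- The realization of a network with `p` parameters has at most `p` hidden layers of width at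
most `p`. -/
theorem exists_isReluNet_realize {a : ℝ → ℝ} (ha : ∀ x, a x = max x 0) {m n : ℕ}
    (Φ : ANN m n) : ∃ h ≤ Φ.paramCount, IsReluNet Φ.paramCount h (Φ.realize a) := by
  induction Φ with
  | last hm hn W B => exact ⟨0, Nat.zero_le _, isReluNet_affineLayer W B⟩
  | @cons m k n hm W B Φ ih =>
    obtain ⟨h, hle, hh⟩ := ih
    have hk := Φ.pos_left
    -- A layer contributes at least its width, which is positive, to the parameter count; this
    -- bounds both width and depth.
    have : k * 1 ≤ k * (m + 1) := Nat.mul_le_mul_left _ (by omega)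
    obtain ⟨A, hA⟩ := isReluNet_affineLayer (w := 0) W B
    refine ⟨h + 1, by simp only [paramCount]; omega, Fin k, inferInstance, ⟨⟨0, hk⟩⟩,
      (WithLp.linearEquiv 2 ℝ (Fin k → ℝ)).toLinearMap.toAffineMap.comp A,
      fun u => Φ.realize a (WithLp.toLp 2 u), by simp [paramCount]; omega, ?_, ?_⟩
    · refine (hh.mono (by simp [paramCount])).comp_affine (f := WithLp.toLp 2)
        (.of_add_smul (fun x y => by ext; simp) (fun c x => by ext; simp))
    · intro x
      simp [realize, multidim, ha, hA]

theorem exists_matrix_of_affineMap {m n : ℕ} (A : RVec m →ᵃ[ℝ] RVec n) :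
    ∃ (W : Matrix (Fin n) (Fin m) ℝ) (B : Fin n → ℝ), ∀ x, A x = affineLayer W B x := by
  let L : (Fin m → ℝ) →ₗ[ℝ] (Fin n → ℝ) :=
    (WithLp.linearEquiv 2 ℝ (Fin n → ℝ)).toLinearMap ∘ₗ A.linear ∘ₗ
      (WithLp.linearEquiv 2 ℝ (Fin m → ℝ)).symm.toLinearMap
  refine ⟨LinearMap.toMatrix' L, (A 0).ofLp, fun x => ?_⟩
  have hA : A x = A.linear x + A 0 := congrFun A.decomp x
  rw [affineLayer, LinearMap.toMatrix'_mulVec, hA]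
  simp [L]

/-- Every function realized by a ReLU network in the sense of `IsReluNet` is the realization
of an `ANN`. -/
theorem exists_realize_eq {a : ℝ → ℝ} (ha : ∀ x, a x = max x 0) {w h m n : ℕ} (hm : 0 < m)
    (hn : 0 < n) (hmw : m ≤ w) (hnw : n ≤ w) {f : RVec m → RVec n} (hf : IsReluNet w h f) :
    ∃ Ψ : ANN m n, (∀ x, Ψ.realize a x = f x) ∧ Ψ.paramCount ≤ (h + 1) * (w * (w + 1)) := by
  induction h generalizing m with
  | zero =>
    obtain ⟨A, hA⟩ := hf
    obtain ⟨W, B, hWB⟩ := exists_matrix_of_affineMap A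
    refine ⟨.last hm hn W B, fun x => by simp [realize, hA, hWB], ?_⟩
    simp only [paramCount, zero_add, one_mul]
    gcongr
  | succ h ih =>
    obtain ⟨σ, i₁, i₂, A, g, hσ, hg, hfg⟩ := hf
    let e := Fintype.equivFin σ
    let A' : RVec m →ᵃ[ℝ] RVec (Fintype.card σ) :=
      ((WithLp.linearEquiv 2 ℝ (Fin (Fintype.card σ) → ℝ)).symm.toLinearMap ∘ₗ
        LinearMap.funLeft ℝ ℝ e.symm).toAffineMap.comp A
    obtain ⟨W, B, hWB⟩ := exists_matrix_of_affineMap A'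
    obtain ⟨Ψ, hΨ, hcount⟩ := ih (m := Fintype.card σ) Fintype.card_pos hσ
      (f := fun u => g (fun i => u (e i))) (hg.comp_affine
        (f := fun (u : RVec (Fintype.card σ)) i => u (e i))
        (.of_add_smul (fun x y => by ext; simp) (fun c x => by ext; simp)))
    refine ⟨.cons hm W B Ψ, fun x => ?_, ?_⟩
    · simp [realize, hΨ, hfg, multidim, ← hWB, ha, A', LinearMap.funLeft]
    · simp only [paramCount]
      rw [add_mul (h + 1), one_mul, add_comm]
      gcongr

end ANN

/-! ### ReLU approximation of squares and products -/

/-- The projection of the real line onto `[0, 1]`, written with ReLU functions. -/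
def clipUnit (u : ℝ) : ℝ := max u 0 - max (u - 1) 0

/-- The projection of the real line onto `[-R, R]`, written with ReLU functions. -/
def clipSymm (R v : ℝ) : ℝ := max (v + R) 0 - max (v - R) 0 - R

/-- A step of the approximation of squares on `[0, 1]`: the first component is the tent map, and
the quantity `b + x ^ 2` is multiplied by `4`. -/
def squareStep (p : ℝ × ℝ) : ℝ × ℝ :=
  (2 * p.1 - 4 * max (p.1 - 1 / 2) 0, 4 * p.2 + 8 * max (p.1 - 1 / 2) 0)

/-- A ReLU approximation of the square function on `[0, 1]`. -/
def squareApprox (m : ℕ) (x : ℝ) : ℝ := (squareStep^[m] (x, 0)).2 / 4 ^ m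

/-- A ReLU approximation of `(u, v) ↦ clipUnit u * clipSymm R v`. -/
def prodApprox (m : ℕ) (R u v : ℝ) : ℝ :=
  R * (squareApprox m (|clipUnit u + clipSymm R v / R| / 2) -
    squareApprox m (|clipUnit u - clipSymm R v / R| / 2))

theorem clipUnit_of_nonpos {u : ℝ} (hu : u ≤ 0) : clipUnit u = 0 := by
  rw [clipUnit, max_eq_right hu, max_eq_right (by linarith), sub_zero]

theorem clipUnit_of_mem {u : ℝ} (h0 : 0 ≤ u) (h1 : u ≤ 1) : clipUnit u = u := by
  rw [clipUnit, max_eq_left h0, max_eq_right (by linarith), sub_zero]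

theorem clipUnit_of_one_le {u : ℝ} (h1 : 1 ≤ u) : clipUnit u = 1 := by
  rw [clipUnit, max_eq_left (by linarith), max_eq_left (by linarith)]; ring

theorem clipUnit_mem (u : ℝ) : 0 ≤ clipUnit u ∧ clipUnit u ≤ 1 := by
  rcases le_total u 0 with h | h
  · simp [clipUnit_of_nonpos h]
  · rcases le_total u 1 with h' | h'
    · rw [clipUnit_of_mem h h']; exact ⟨h, h'⟩
    · simp [clipUnit_of_one_le h']

theorem abs_clipSymm_le {R : ℝ} (hR : 0 < R) (v : ℝ) : |clipSymm R v| ≤ R := by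
  unfold clipSymm
  rw [abs_le]
  rcases max_cases (v + R) 0 with h | h <;> rcases max_cases (v - R) 0 with h' | h' <;>
    constructor <;> linarith

/-- Clipping changes `v` only if `|v| > R`, and then by at most `|v| ≤ v ^ 2 / R`. -/
theorem abs_sub_clipSymm_le {R : ℝ} (hR : 0 < R) (v : ℝ) :
    |v - clipSymm R v| ≤ R⁻¹ * v ^ 2 := by
  have key : R * |v - clipSymm R v| ≤ v ^ 2 := by
    unfold clipSymm
    rcases max_cases (v + R) 0 with h | h <;> rcases max_cases (v - R) 0 with h' | h' <;>
      rw [h.1, h'.1]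
    · rw [abs_of_nonneg (by linarith)]; nlinarith
    · simp [sq_nonneg]
    · linarith
    · rw [abs_of_nonpos (by linarith)]; nlinarith
  rwa [inv_mul_eq_div, le_div_iff₀' hR]

/-- On either side of `1 / 2` the kink term exactly compensates the tent map. The invariant leaves
the square of a point of `[0, 1]` as the remainder, which division by `4 ^ m` makes small. -/
theorem squareStep_iterate (m : ℕ) {p : ℝ × ℝ} (h0 : 0 ≤ p.1) (h1 : p.1 ≤ 1) :
    0 ≤ (squareStep^[m] p).1 ∧ (squareStep^[m] p).1 ≤ 1 ∧
      (squareStep^[m] p).2 + (squareStep^[m] p).1 ^ 2 = 4 ^ m * (p.2 + p.1 ^ 2) := by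
  induction m with
  | zero => simp [h0, h1]
  | succ m ih =>
    rw [Function.iterate_succ_apply', pow_succ' 4, mul_assoc]
    obtain ⟨h0, h1, h2⟩ := ih
    rw [← h2]
    generalize squareStep^[m] p = q at *
    simp only [squareStep]
    rcases max_cases (q.1 - 1 / 2) 0 with h | h <;> rw [h.1] <;>
      refine ⟨by linarith, by linarith, by ring⟩

theorem squareApprox_bounds (m : ℕ) {x : ℝ} (h0 : 0 ≤ x) (h1 : x ≤ 1) :
    squareApprox m x ≤ x ^ 2 ∧ x ^ 2 ≤ squareApprox m x + (4 ^ m)⁻¹ := by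
  obtain ⟨h0, h1, h2⟩ := squareStep_iterate m (p := (x, 0)) h0 h1
  have h4 : (0 : ℝ) < 4 ^ m := by positivity
  unfold squareApprox
  generalize squareStep^[m] (x, 0) = q at *
  simp only [zero_add] at h2
  constructor
  · rw [div_le_iff₀ h4]; nlinarith
  · rw [inv_eq_one_div, ← add_div, le_div_iff₀ h4]; nlinarith

/-- Both squares have the same argument and cancel exactly, whatever their approximation error. -/
theorem prodApprox_of_nonpos (m : ℕ) (R : ℝ) {u : ℝ} (hu : u ≤ 0) (v : ℝ) :
    prodApprox m R u v = 0 := by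
  simp [prodApprox, clipUnit_of_nonpos hu]

theorem abs_sub_prodApprox_le {m : ℕ} {ε : ℝ} (hε : 0 < ε) (hm : (4 ^ m : ℝ)⁻¹ ≤ ε ^ 2)
    (u v : ℝ) : |clipUnit u * v - prodApprox m ε⁻¹ u v| ≤ ε * (1 + v ^ 2) := by
  have hR : 0 < ε⁻¹ := inv_pos.2 hε
  obtain ⟨hs0, hs1⟩ := clipUnit_mem u
  have hv := abs_sub_clipSymm_le hR v
  have hc := abs_clipSymm_le hR v
  unfold prodApprox
  rw [inv_inv] at hv
  generalize clipUnit u = s at *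
  generalize clipSymm ε⁻¹ v = c at *
  simp only [div_inv_eq_mul]
  have hw : |c * ε| ≤ 1 := by
    rw [abs_mul, abs_of_pos hε]
    calc |c| * ε ≤ ε⁻¹ * ε := by gcongr
      _ = 1 := inv_mul_cancel₀ hε.ne'
  have hcw : c = ε⁻¹ * (c * ε) := by field_simp
  generalize c * ε = w at *
  rw [abs_le] at hw
  obtain ⟨ha, hb⟩ := squareApprox_bounds m (x := |s + w| / 2) (by positivity) (by
    have : |s + w| ≤ 2 := abs_le.2 ⟨by linarith, by linarith⟩
    linarith)
  obtain ⟨ha', hb'⟩ := squareApprox_bounds m (x := |s - w| / 2) (by positivity) (by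
    have : |s - w| ≤ 2 := abs_le.2 ⟨by linarith, by linarith⟩
    linarith)
  rw [div_pow, sq_abs] at ha hb ha' hb'
  generalize squareApprox m (|s + w| / 2) = q at *
  generalize squareApprox m (|s - w| / 2) = q' at *
  -- Polarization: `s * w = ((s + w) / 2) ^ 2 - ((s - w) / 2) ^ 2`. Both square errors lie in `[0,
  -- 4⁻ᵐ]`, so they do not add up in the difference; the later factor `ε⁻¹` turns `ε ^ 2` into `ε`.
  have h1 : |s * w - (q - q')| ≤ ε ^ 2 := abs_le.2 ⟨by nlinarith, by nlinarith⟩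
  have h2 : s * v - ε⁻¹ * (q - q') = s * (v - c) + ε⁻¹ * (s * w - (q - q')) := by
    rw [mul_sub, hcw]; ring
  rw [h2]
  calc |s * (v - c) + ε⁻¹ * (s * w - (q - q'))|
      ≤ s * |v - c| + ε⁻¹ * |s * w - (q - q')| := by
        refine (abs_add_le _ _).trans ?_
        rw [abs_mul, abs_mul, abs_of_nonneg hs0, abs_of_pos hR]
    _ ≤ 1 * (ε * v ^ 2) + ε⁻¹ * ε ^ 2 := by gcongr
    _ = ε * (1 + v ^ 2) := by field_simp; ring

theorem continuous_prodApprox (m : ℕ) (R u : ℝ) : Continuous (prodApprox m R u) := by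
  have hs : Continuous squareStep := by unfold squareStep; fun_prop
  have hq : Continuous (squareApprox m) := by
    unfold squareApprox
    exact ((continuous_snd.comp (hs.iterate m)).comp (by fun_prop)).div_const _
  have hc : Continuous (clipSymm R) := by unfold clipSymm; fun_prop
  unfold prodApprox
  fun_prop

namespace IsReluNet

theorem squareStep : IsReluNet 5 1 squareStep := by
  -- Four neurons carry the two inputs as positive and negative parts; the fifth is the kink of the
  -- tent map.
  refine of_layer (σ := Fin 5) (by simp)
    (A := fun p => ![p.1, -p.1, p.2, -p.2, p.1 - 1 / 2])
    (B := fun z => (2 * (z 0 - z 1) - 4 * z 4, 4 * (z 2 - z 3) + 8 * z 4))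
    (of_add_smul (fun x y => ?_) (fun c x => ?_))
    (of_add_smul (fun x y => ?_) (fun c x => ?_)) (fun p => ?_)
  · ext i; fin_cases i <;> simp <;> ring
  · ext i; fin_cases i <;> simp <;> ring
  · ext <;> simp <;> ring
  · ext <;> simp <;> ring
  · have h (z : ℝ) : max z 0 - max (-z) 0 = z := max_zero_sub_max_neg_zero_eq_self z
    ext <;> simp [_root_.squareStep, h]

theorem squareApprox (m : ℕ) : IsReluNet 5 m (squareApprox m) := by
  have hit : IsReluNet 5 m (_root_.squareStep^[m]) := by
    induction m with
    | zero => exact of_add_smul (fun x y => by simp) (fun c x => by simp)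
    | succ m ih =>
      exact (squareStep.comp ih).congr fun x => Function.iterate_succ_apply' _ _ _
  have h₁ : IsReluNet 5 0 (fun x : ℝ => (x, (0 : ℝ))) :=
    of_add_smul (fun x y => by simp) (fun c x => by simp)
  have h₂ : IsReluNet 5 0 (fun p : ℝ × ℝ => p.2 / 4 ^ m) :=
    of_add_smul (fun x y => by simp; ring) (fun c x => by simp; ring)
  exact h₂.comp (hit.comp_affine h₁)

theorem prodApprox (m : ℕ) (R : ℝ) :
    IsReluNet 10 (m + 2) (fun p : ℝ × ℝ => prodApprox m R p.1 p.2) := by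
  have h₁ : IsReluNet 10 1 (fun p : ℝ × ℝ => (clipUnit p.1, clipSymm R p.2 / R)) := by
    refine of_layer (σ := Fin 4) (by simp)
      (A := fun p => ![p.1, p.1 - 1, p.2 + R, p.2 - R])
      (B := fun z => (z 0 - z 1, (z 2 - z 3 - R) / R))
      (of_add_smul (fun x y => ?_) (fun c x => ?_))
      (of_add_smul (fun x y => ?_) (fun c x => ?_)) (fun p => ?_)
    · ext i; fin_cases i <;> simp <;> ring
    · ext i; fin_cases i <;> simp <;> ring
    · ext <;> simp <;> ring
    · ext <;> simp <;> ring
    · simp [clipUnit, clipSymm]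
  have h₂ : IsReluNet 10 1 (fun p : ℝ × ℝ => ![|p.1 + p.2| / 2, |p.1 - p.2| / 2]) := by
    refine of_layer (σ := Fin 4) (by simp)
      (A := fun p => ![p.1 + p.2, -(p.1 + p.2), p.1 - p.2, -(p.1 - p.2)])
      (B := fun z => ![(z 0 + z 1) / 2, (z 2 + z 3) / 2])
      (of_add_smul (fun x y => ?_) (fun c x => ?_))
      (of_add_smul (fun x y => ?_) (fun c x => ?_)) (fun p => ?_)
    · ext i; fin_cases i <;> simp <;> ring
    · ext i; fin_cases i <;> simp <;> ring
    · ext i; fin_cases i <;> simp <;> ring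
    · ext i; fin_cases i <;> simp <;> ring
    · have h (z : ℝ) : |z| = max z 0 + max (-z) 0 := (max_zero_add_max_neg_zero_eq_abs_self z).symm
      ext i; fin_cases i
      · simp [h (p.1 + p.2)]
      · simp [h (p.1 - p.2)]
  have h₃ : IsReluNet 10 m (fun (x : Fin 2 → ℝ) i => _root_.squareApprox m (x i)) :=
    (squareApprox m).pi.mono (by simp)
  have h₄ : IsReluNet 10 0 (fun x : Fin 2 → ℝ => R * (x 0 - x 1)) :=
    of_add_smul (fun x y => by simp; ring) (fun c x => by simp; ring)
  have h := h₄.comp (h₃.comp (h₂.comp h₁))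
  rw [show m + 2 = 1 + 1 + m + 0 by omega]
  exact h.congr fun p => by simp [_root_.prodApprox]

end IsReluNet

/-! ### The perturbed Euler scheme: networks, error and growth -/

section Euler

variable {d : ℕ}

/-- The grid points of the perturbed Euler scheme with step size `τ`. -/
def eulerPoint (τ : ℝ) (f : RVec d → RVec d) (y : ℕ → RVec d) (x : RVec d) : ℕ → RVec d
  | 0 => x
  | n + 1 => eulerPoint τ f y x n + (τ • f (eulerPoint τ f y x n) + y n)

/-- The increments of the perturbed Euler scheme with step size `τ`. -/
def eulerIncr (τ : ℝ) (f : RVec d → RVec d) (y : ℕ → RVec d) (x : RVec d) (n : ℕ) : RVec d :=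
  τ • f (eulerPoint τ f y x n) + y n

/-- The interpolation of the first `n` steps of the perturbed Euler scheme, where
`(u, v) ↦ clipUnit u * v` may be replaced by an approximation `P`. -/
def eulerInterp (P : ℝ → ℝ → ℝ) (τ : ℝ) (f : RVec d → RVec d) (y : ℕ → RVec d) (n : ℕ) (t : ℝ)
    (x : RVec d) : RVec d :=
  x + ∑ k ∈ Finset.range n, WithLp.toLp 2 fun i => P (t / τ - k) (eulerIncr τ f y x k i)

theorem eulerPoint_succ (τ : ℝ) (f : RVec d → RVec d) (y : ℕ → RVec d) (x : RVec d) (n : ℕ) :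
    eulerPoint τ f y x (n + 1) = eulerPoint τ f y x n + eulerIncr τ f y x n := rfl

theorem eulerPoint_eq_add_sum (τ : ℝ) (f : RVec d → RVec d) (y : ℕ → RVec d) (x : RVec d)
    (n : ℕ) : eulerPoint τ f y x n = x + ∑ k ∈ Finset.range n, eulerIncr τ f y x k := by
  induction n with
  | zero => simp [eulerPoint]
  | succ n ih => rw [eulerPoint_succ, ih, Finset.sum_range_succ, add_assoc]

/-- Up to the time `n * τ` the interpolation only depends on the first `n` perturbations. -/
theorem eulerInterp_congr {P : ℝ → ℝ → ℝ} (hP : ∀ u ≤ 0, ∀ v, P u v = 0) {τ : ℝ} (hτ : 0 < τ)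
    (f : RVec d → RVec d) {y z : ℕ → RVec d} {n : ℕ} (hyz : ∀ k < n, y k = z k) (N : ℕ) {t : ℝ}
    (ht : t ≤ n * τ) (x : RVec d) :
    eulerInterp P τ f y N t x = eulerInterp P τ f z N t x := by
  have hpt : ∀ k ≤ n, eulerPoint τ f y x k = eulerPoint τ f z x k := by
    intro k
    induction k with
    | zero => intro; rfl
    | succ k ih => intro hk; rw [eulerPoint, eulerPoint, ih (by omega), hyz k hk]
  unfold eulerInterp
  congr 1
  refine Finset.sum_congr rfl fun k _ => ?_
  rcases lt_or_ge k n with hk | hk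
  · rw [eulerIncr, eulerIncr, hpt k hk.le, hyz k hk]
  · have : t / τ - k ≤ 0 := by
      rw [sub_nonpos, div_le_iff₀ hτ]
      exact ht.trans (by gcongr)
    simp [hP _ this]

theorem continuous_eulerInterp {P : ℝ → ℝ → ℝ} (hP : ∀ u, Continuous (P u)) (τ : ℝ)
    {f : RVec d → RVec d} (hf : Continuous f) (n : ℕ) (t : ℝ) (x : RVec d) :
    Continuous fun y : ℕ → RVec d => eulerInterp P τ f y n t x := by
  have hpt (k : ℕ) : Continuous fun y : ℕ → RVec d => eulerPoint τ f y x k := by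
    induction k with
    | zero => exact continuous_const
    | succ k ih => unfold eulerPoint; fun_prop
  unfold eulerInterp eulerIncr
  fun_prop

/-- Each step runs `f` on a copy of the grid point and then `d` copies of `P`, while the state of
dimension `2 * d + 1` (time, grid point, partial interpolation) passes alongside. The exact grid
point is carried separately, so errors of `P` never enter `f`. The perturbations enter only as
biases. -/
theorem isReluNet_eulerInterp (hd : 0 < d) {P : ℝ → ℝ → ℝ} {p q H M : ℕ}
    {f : RVec d → RVec d} (hf : IsReluNet p H f)
    (hP : IsReluNet q M (fun z : ℝ × ℝ => P z.1 z.2)) (τ : ℝ) (y : ℕ → RVec d) (n : ℕ) :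
    IsReluNet (p + d * q + 2 * (2 * d + 1)) (n * (H + M)) (fun z : RVec (d + 1) =>
      eulerInterp P τ f y n (z 0) (WithLp.toLp 2 fun i => z i.succ)) := by
  have : Nonempty (Fin d) := ⟨⟨0, hd⟩⟩
  set w := p + d * q + 2 * (2 * d + 1)
  have hrank : Module.finrank ℝ (ℝ × RVec d × RVec d) = 2 * d + 1 := by
    simp only [Module.finrank_prod, Module.finrank_self, finrank_euclideanSpace_fin]; ring
  have hstate : IsReluNet w (n * (H + M)) (fun z : RVec (d + 1) =>
      (z 0, eulerPoint τ f y (WithLp.toLp 2 fun i => z i.succ) n,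
        eulerInterp P τ f y n (z 0) (WithLp.toLp 2 fun i => z i.succ))) := by
    induction n with
    | zero =>
      rw [zero_mul]
      refine .of_add_smul (fun x y => ?_) (fun c x => ?_) <;>
        refine Prod.ext ?_ (Prod.ext ?_ ?_) <;> try ext
      all_goals simp [eulerPoint, eulerInterp]
    | succ n ih =>
      have h₁ : IsReluNet w 0 (fun s : ℝ × RVec d × RVec d => (s.2.1, s)) :=
        .of_add_smul (fun x y => by simp) (fun c x => by simp)
      have h₂ : IsReluNet w H (fun s : RVec d × (ℝ × RVec d × RVec d) => (f s.1, s.2)) :=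
        hf.prod_id.mono (by rw [hrank]; omega)
      have h₃ : IsReluNet w 0 (fun s : RVec d × (ℝ × RVec d × RVec d) =>
          ((fun i : Fin d => (s.2.1 / τ - n, (τ • s.1 + y n) i)),
            (s.2.1, s.2.2.1 + (τ • s.1 + y n), s.2.2.2))) := by
        refine .of_add_smul (fun x y => ?_) (fun c x => ?_)
        · refine Prod.ext ?_ (Prod.ext ?_ (Prod.ext ?_ ?_))
          · ext i <;> simp <;> ring
          · simp
          · ext i; simp; ring
          · simp
        · refine Prod.ext ?_ (Prod.ext ?_ (Prod.ext ?_ ?_))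
          · ext i <;> simp <;> ring
          · simp
          · ext i; simp; ring
          · simp
      have h₄ : IsReluNet w M (fun s : (Fin d → ℝ × ℝ) × (ℝ × RVec d × RVec d) =>
          ((fun i => P (s.1 i).1 (s.1 i).2), s.2)) :=
        (hP.pi (κ := Fin d)).prod_id.mono (by rw [hrank, Fintype.card_fin]; omega)
      have h₅ : IsReluNet w 0 (fun s : (Fin d → ℝ) × (ℝ × RVec d × RVec d) =>
          (s.2.1, s.2.2.1, s.2.2.2 + WithLp.toLp 2 s.1)) := by
        refine .of_add_smul (fun x y => ?_) (fun c x => ?_)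
        · refine Prod.ext ?_ (Prod.ext ?_ ?_)
          · simp
          · simp
          · ext i; simp; ring
        · refine Prod.ext ?_ (Prod.ext ?_ ?_)
          · simp
          · simp
          · ext i; simp
      have h := (h₅.comp (h₄.comp (h₃.comp (h₂.comp_affine h₁)))).comp ih
      rw [show (n + 1) * (H + M) = n * (H + M) + (H + 0 + M + 0) by ring]
      refine h.congr fun z => ?_
      refine Prod.ext rfl (Prod.ext rfl ?_)
      simp only [eulerInterp, Finset.sum_range_succ, add_assoc, eulerIncr]
  have hsnd : IsReluNet w 0 (fun s : ℝ × RVec d × RVec d => s.2.2) :=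
    .of_add_smul (fun x y => by simp) (fun c x => by simp)
  exact hsnd.comp hstate

/-- The constant vector 1 has norm `√d`, and the vector of squares `v i ^ 2` has norm at most `‖v‖ ^
2`. -/
theorem norm_toLp_le_of_abs_le {ε : ℝ} (hε : 0 ≤ ε) (v : RVec d) {e : Fin d → ℝ}
    (he : ∀ i, |e i| ≤ ε * (1 + v i ^ 2)) :
    ‖(WithLp.toLp 2 e : RVec d)‖ ≤ ε * (√d + ‖v‖ ^ 2) := by
  refine abs_le_of_sq_le_sq' ?_ (by positivity) |>.2
  rw [EuclideanSpace.norm_sq_eq, EuclideanSpace.norm_sq_eq, mul_pow]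
  simp only [Real.norm_eq_abs, sq_abs]
  have h1 : ∑ i, e i ^ 2 ≤ ∑ i, ε ^ 2 * (1 + 2 * v i ^ 2 + (v i ^ 2) ^ 2) :=
    Finset.sum_le_sum fun i _ => by
      have := pow_le_pow_left₀ (abs_nonneg _) (he i) 2
      rw [sq_abs] at this
      linarith
  rw [← Finset.mul_sum, Finset.sum_add_distrib, Finset.sum_add_distrib, ← Finset.mul_sum] at h1
  have h2 : ∑ i, (v i ^ 2) ^ 2 ≤ (∑ i, v i ^ 2) ^ 2 :=
    Finset.sum_sq_le_sq_sum_of_nonneg fun i _ => sq_nonneg _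
  have h3 : (d : ℝ) + 2 * ∑ i, v i ^ 2 ≤ √d ^ 2 + 2 * √d * ∑ i, v i ^ 2 := by
    rcases Nat.eq_zero_or_pos d with rfl | hd
    · simp
    · have : 1 ≤ √(d : ℝ) := Real.one_le_sqrt.2 (by exact_mod_cast hd)
      have h0 : 0 ≤ ∑ i, v i ^ 2 := Finset.sum_nonneg fun i _ => sq_nonneg _
      rw [Real.sq_sqrt (by positivity)]
      nlinarith
  refine h1.trans ?_
  gcongr
  simp only [Finset.sum_const, Finset.card_univ, Fintype.card_fin, nsmul_eq_mul, mul_one]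
  nlinarith

theorem norm_eulerInterp_sub_le {P : ℝ → ℝ → ℝ} {ε : ℝ} (hε : 0 ≤ ε)
    (hP : ∀ u v, |clipUnit u * v - P u v| ≤ ε * (1 + v ^ 2)) (τ : ℝ) (f : RVec d → RVec d)
    (y : ℕ → RVec d) (n : ℕ) (t : ℝ) (x : RVec d) :
    ‖eulerInterp (fun u v => clipUnit u * v) τ f y n t x - eulerInterp P τ f y n t x‖ ≤
      ε * (n * √d + ∑ k ∈ Finset.range n, ‖eulerIncr τ f y x k‖ ^ 2) := by
  unfold eulerInterp
  rw [add_sub_add_left_eq_sub, ← Finset.sum_sub_distrib]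
  refine (norm_sum_le_of_le _ fun k _ => ?_).trans_eq (b := ∑ k ∈ Finset.range n,
    ε * (√d + ‖eulerIncr τ f y x k‖ ^ 2)) ?_
  · rw [← WithLp.toLp_sub]
    exact norm_toLp_le_of_abs_le hε _ fun i => hP _ _
  · rw [← Finset.mul_sum, Finset.sum_add_distrib]
    simp

theorem norm_eulerInterp_le (τ : ℝ) (f : RVec d → RVec d)
    (y : ℕ → RVec d) (n : ℕ) (t : ℝ) (x : RVec d) :
    ‖eulerInterp (fun u v => clipUnit u * v) τ f y n t x‖ ≤
      ‖x‖ + (n + ∑ k ∈ Finset.range n, ‖eulerIncr τ f y x k‖ ^ 2) := by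
  unfold eulerInterp
  refine (norm_add_le _ _).trans (add_le_add_right ?_ _)
  refine (norm_sum_le_of_le _ fun k _ => ?_).trans_eq (b := ∑ k ∈ Finset.range n,
    (1 + ‖eulerIncr τ f y x k‖ ^ 2)) ?_
  · obtain ⟨h0, h1⟩ := clipUnit_mem (t / τ - k)
    change ‖clipUnit (t / τ - k) • eulerIncr τ f y x k‖ ≤ _
    rw [norm_smul, Real.norm_eq_abs, abs_of_nonneg h0]
    nlinarith [norm_nonneg (eulerIncr τ f y x k), sq_nonneg (‖eulerIncr τ f y x k‖ - 1)]
  · rw [Finset.sum_add_distrib]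
    simp

/-- Discrete Gronwall: adding 1 to the norm makes the linear growth bound homogeneous, so a step
multiplies by `1 + 𝔠 * τ` and adds `‖y n‖`. -/
theorem one_add_norm_eulerPoint_le {𝔠 τ : ℝ} (h𝔠 : 0 ≤ 𝔠) (hτ : 0 ≤ τ) {f : RVec d → RVec d}
    (hf : ∀ x, ‖f x‖ ≤ 𝔠 * (1 + ‖x‖)) (y : ℕ → RVec d) (x : RVec d) (n : ℕ) :
    1 + ‖eulerPoint τ f y x n‖ ≤
      (1 + 𝔠 * τ) ^ n * (1 + ‖x‖ + ∑ k ∈ Finset.range n, ‖y k‖) := by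
  induction n with
  | zero => simp [eulerPoint]
  | succ n ih =>
    have h1 : 1 ≤ (1 + 𝔠 * τ) ^ (n + 1) := one_le_pow₀ (by nlinarith [mul_nonneg h𝔠 hτ])
    have h2 : ‖eulerPoint τ f y x (n + 1)‖ ≤ ‖eulerPoint τ f y x n‖ +
        (τ * (𝔠 * (1 + ‖eulerPoint τ f y x n‖)) + ‖y n‖) := by
      refine (norm_add_le _ _).trans (add_le_add_right ((norm_add_le _ _).trans ?_) _)
      rw [norm_smul, Real.norm_eq_abs, abs_of_nonneg hτ]
      gcongr
      exact hf _
    have h3 : (1 + 𝔠 * τ) * (1 + ‖eulerPoint τ f y x n‖) ≤ (1 + 𝔠 * τ) *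
      ((1 + 𝔠 * τ) ^ n * (1 + ‖x‖ + ∑ k ∈ Finset.range n, ‖y k‖)) := by gcongr
    have h4 := le_mul_of_one_le_left (norm_nonneg (y n)) h1
    rw [Finset.sum_range_succ, ← add_assoc, mul_add]
    rw [← mul_assoc, ← pow_succ'] at h3
    nlinarith

/-- One factor `N` comes from the number of steps, another from Cauchy–Schwarz for `∑ ‖y k‖`; the
factor `τ ^ 2` from the drift absorbs both. For `N * τ = T` the constant does not depend on `N`. -/
theorem sum_norm_eulerIncr_sq_le {𝔠 τ Y : ℝ} (h𝔠 : 0 ≤ 𝔠) (hτ : 0 ≤ τ) {f : RVec d → RVec d}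
    (hf : ∀ x, ‖f x‖ ≤ 𝔠 * (1 + ‖x‖)) (y : ℕ → RVec d) (x : RVec d) {N : ℕ}
    (hY : ∑ k ∈ Finset.range N, ‖y k‖ ^ 2 = Y) :
    ∑ k ∈ Finset.range N, ‖eulerIncr τ f y x k‖ ^ 2 ≤
      (6 * (𝔠 * (N * τ)) ^ 2 * Real.exp (𝔠 * (N * τ)) ^ 2 + 2) * (1 + ‖x‖ ^ 2 + Y) := by
  set S := ∑ k ∈ Finset.range N, ‖y k‖
  set Q := Real.exp (𝔠 * (N * τ))
  have hY0 : 0 ≤ Y := by rw [← hY]; positivity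
  have hS : S ^ 2 ≤ N * Y := by
    simpa [hY] using sq_sum_le_card_mul_sum_sq (s := Finset.range N) (f := fun k => ‖y k‖)
  have hS0 : 0 ≤ S := by positivity
  have hc : 0 ≤ 𝔠 * τ := mul_nonneg h𝔠 hτ
  have hpt : ∀ k < N, 1 + ‖eulerPoint τ f y x k‖ ≤ Q * (1 + ‖x‖ + S) := by
    intro k hk
    refine (one_add_norm_eulerPoint_le h𝔠 hτ hf y x k).trans ?_
    gcongr ?_ * (_ + ?_)
    · calc (1 + 𝔠 * τ) ^ k ≤ (1 + 𝔠 * τ) ^ N := pow_le_pow_right₀ (by linarith) hk.le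
        _ ≤ Real.exp (𝔠 * τ) ^ N := by
          gcongr
          linarith [Real.add_one_le_exp (𝔠 * τ)]
        _ = Q := by rw [← Real.exp_nat_mul]; congr 1; ring
    · exact Finset.sum_le_sum_of_subset_of_nonneg (Finset.range_mono hk.le)
        fun _ _ _ => norm_nonneg _
  have hinc : ∀ k ∈ Finset.range N, ‖eulerIncr τ f y x k‖ ^ 2 ≤
      2 * (𝔠 * τ * (Q * (1 + ‖x‖ + S))) ^ 2 + 2 * ‖y k‖ ^ 2 := by
    intro k hk
    have h1 : ‖eulerIncr τ f y x k‖ ≤ 𝔠 * τ * (Q * (1 + ‖x‖ + S)) + ‖y k‖ := by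
      refine (norm_add_le _ _).trans (add_le_add_left ?_ _)
      rw [norm_smul, Real.norm_eq_abs, abs_of_nonneg hτ, mul_comm 𝔠, mul_assoc]
      gcongr
      refine (hf _).trans ?_
      gcongr
      exact hpt k (Finset.mem_range.1 hk)
    have h2 := pow_le_pow_left₀ (norm_nonneg _) h1 2
    nlinarith [sq_nonneg (𝔠 * τ * (Q * (1 + ‖x‖ + S)) - ‖y k‖)]
  refine (Finset.sum_le_sum hinc).trans ?_
  rw [Finset.sum_add_distrib, ← Finset.mul_sum _ (fun k => ‖y k‖ ^ 2), hY]
  simp only [Finset.sum_const, Finset.card_range, nsmul_eq_mul]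
  rcases Nat.eq_zero_or_pos N with rfl | hN
  · simp; nlinarith [sq_nonneg ‖x‖]
  have hN1 : (1 : ℝ) ≤ N := by exact_mod_cast hN
  have h1 : (1 + ‖x‖ + S) ^ 2 ≤ 3 * N * (1 + ‖x‖ ^ 2 + Y) := by
    have h3 : (1 + ‖x‖ + S) ^ 2 ≤ 3 * (1 + ‖x‖ ^ 2 + S ^ 2) := by
      nlinarith [sq_nonneg (1 - ‖x‖), sq_nonneg (1 - S), sq_nonneg (‖x‖ - S)]
    nlinarith [mul_le_mul_of_nonneg_right hN1 (by positivity : 0 ≤ 1 + ‖x‖ ^ 2)]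
  calc N * (2 * (𝔠 * τ * (Q * (1 + ‖x‖ + S))) ^ 2) + 2 * Y
      = N * (2 * (𝔠 * τ) ^ 2 * Q ^ 2) * (1 + ‖x‖ + S) ^ 2 + 2 * Y := by ring
    _ ≤ N * (2 * (𝔠 * τ) ^ 2 * Q ^ 2) * (3 * N * (1 + ‖x‖ ^ 2 + Y)) +
        2 * (1 + ‖x‖ ^ 2 + Y) := by
      gcongr
      nlinarith [sq_nonneg ‖x‖]
    _ = _ := by ring

/-- The interpolated Euler scheme is determined by its recursion. -/
theorem eq_eulerInterp {T : ℝ} (hT : 0 < T) {N : ℕ} (hN : 0 < N) (f : RVec d → RVec d)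
    (y : ℕ → RVec d) (x : RVec d) (Y : Set.Icc (0 : ℝ) T → RVec d)
    (hY_zero : ∀ t : Set.Icc (0 : ℝ) T, (t : ℝ) = 0 → Y t = x)
    (hY_step : ∀ (n : ℕ) (s t : Set.Icc (0 : ℝ) T), n < N → (s : ℝ) = n * T / N →
      (t : ℝ) ∈ Set.Icc ((n : ℝ) * T / N) (((n : ℝ) + 1) * T / N) →
      Y t = Y s + ((t : ℝ) * N / T - n) • ((T / N) • f (Y s) + y n))
    (t : Set.Icc (0 : ℝ) T) :
    Y t = eulerInterp (fun u v => clipUnit u * v) (T / N) f y N t x := by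
  have hN0 : (0 : ℝ) < N := by exact_mod_cast hN
  have hgrid : ∀ n ≤ N, ∀ s : Set.Icc (0 : ℝ) T, (s : ℝ) = n * T / N →
      Y s = eulerPoint (T / N) f y x n := by
    intro n
    induction n with
    | zero => intro _ s hs; exact hY_zero s (by simpa using hs)
    | succ n ih =>
      intro hn s hs
      have hs' : (n : ℝ) * T / N ≤ s := by rw [hs]; gcongr; simp
      have hr : (n : ℝ) * T / N ∈ Set.Icc (0 : ℝ) T := ⟨by positivity, hs'.trans s.2.2⟩
      rw [hY_step n ⟨_, hr⟩ s hn rfl ⟨hs', by rw [hs]; push_cast; rfl⟩, ih (by omega) _ rfl,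
        eulerPoint, hs]
      congr 1
      convert one_smul ℝ _
      push_cast
      field_simp
      ring
  -- The floor selects the step containing `t`, except at `t = T`, where it equals `N` and the last
  -- step `N - 1` is used.
  obtain ⟨n, hn, hn0, hn1⟩ : ∃ n < N, (n : ℝ) ≤ (t : ℝ) * N / T ∧
      (t : ℝ) * N / T ≤ n + 1 := by
    have h0 : 0 ≤ (t : ℝ) * N / T := by have := t.2.1; positivity
    rcases lt_or_ge (⌊(t : ℝ) * N / T⌋₊) N with h | h
    · exact ⟨_, h, Nat.floor_le h0, (Nat.lt_floor_add_one _).le⟩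
    · have h1 : (t : ℝ) * N / T ≤ N := by
        rw [div_le_iff₀ hT, mul_comm]; gcongr; exact t.2.2
      have h2 : (N : ℝ) ≤ t * N / T := (Nat.le_floor_iff h0).1 h
      have h3 : ((N - 1 : ℕ) : ℝ) = N - 1 := by simp [Nat.cast_sub (Nat.one_le_of_lt hN)]
      exact ⟨N - 1, by omega, by linarith, by linarith⟩
  have hlow : (n : ℝ) * T / N ≤ t := by
    rw [le_div_iff₀ hT] at hn0; rwa [div_le_iff₀ hN0]
  have hup : (t : ℝ) ≤ (n + 1) * T / N := by
    rw [div_le_iff₀ hT] at hn1; rwa [le_div_iff₀ hN0]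
  rw [hY_step n ⟨n * T / N, by positivity, hlow.trans t.2.2⟩ t hn rfl ⟨hlow, hup⟩,
    hgrid n hn.le _ rfl]
  have hdiv : (t : ℝ) / (T / N) = t * N / T := by field_simp
  obtain ⟨m, hm⟩ : ∃ m, N = n + 1 + m := ⟨N - (n + 1), by omega⟩
  have hrange : Finset.range N = Finset.range (n + 1 + m) := by rw [hm]
  change _ = x + ∑ k ∈ Finset.range N, clipUnit (t / (T / N) - k) • eulerIncr (T / N) f y x k
  -- Steps before `n` have weight 1 and sum to the grid point; step `n` has its interpolation
  -- weight, and later steps have weight 0.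
  have h1 : ∀ k ∈ Finset.range n, clipUnit ((t : ℝ) * N / T - k) • eulerIncr (T / N) f y x k =
      eulerIncr (T / N) f y x k := by
    intro k hk
    have hk : ((k + 1 : ℕ) : ℝ) ≤ n := Nat.cast_le.2 (Finset.mem_range.1 hk)
    rw [Nat.cast_add_one] at hk
    rw [clipUnit_of_one_le (by linarith), one_smul]
  rw [hdiv, hrange, Finset.sum_range_add, Finset.sum_range_succ, Finset.sum_congr rfl h1,
    Finset.sum_eq_zero (s := Finset.range m), add_zero,
    clipUnit_of_mem (by linarith) (by linarith), ← add_assoc, ← eulerPoint_eq_add_sum]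
  · rfl
  · intro k _
    rw [clipUnit_of_nonpos, zero_smul]
    push_cast
    linarith [(Nat.cast_nonneg k : (0 : ℝ) ≤ k)]

end Euler

/-! ### Choice of the depth and parameter count -/

theorem exists_inv_four_pow_le_sq {ε : ℝ} (h0 : 0 < ε) (h1 : ε ≤ 1) :
    ∃ m : ℕ, (4 ^ m : ℝ)⁻¹ ≤ ε ^ 2 ∧ (m : ℝ) ≤ 2 * |Real.log ε| + 1 := by
  -- As `4 ≥ e`, this choice gives `4⁻ᵐ ≤ e⁻ᵐ ≤ ε ^ 2`.
  refine ⟨⌈2 * |Real.log ε|⌉₊, ?_, (Nat.ceil_lt_add_one (by positivity)).le⟩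
  set m := ⌈2 * |Real.log ε|⌉₊
  have hm : 2 * |Real.log ε| ≤ m := Nat.le_ceil _
  rw [abs_of_nonpos (Real.log_nonpos h0.le h1)] at hm
  have h4 : Real.exp m ≤ 4 ^ m := by
    rw [← Real.exp_one_pow]
    gcongr
    linarith [Real.exp_one_lt_d9]
  calc (4 ^ m : ℝ)⁻¹ ≤ (Real.exp m)⁻¹ := inv_anti₀ (Real.exp_pos _) h4
    _ = Real.exp (-m) := (Real.exp_neg _).symm
    _ ≤ Real.exp (2 * Real.log ε) := Real.exp_le_exp.2 (by linarith)
    _ = ε ^ 2 := by rw [two_mul, Real.exp_add, Real.exp_log h0, sq]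

/-- The parameter count of the networks that approximate perturbed Euler schemes. -/
theorem paramCount_bound {𝔠 𝔡 l : ℝ} (h𝔠 : 0 < 𝔠) (h𝔡 : 0 < 𝔡) {d N p H m : ℕ}
    (hd : 0 < d) (hN : 0 < N) (hp : (p : ℝ) ≤ 𝔠 * (d : ℝ) ^ 𝔡) (hH : H ≤ p)
    (hm : (m : ℝ) ≤ 2 * l + 1) :
    (((N * (H + (m + 2)) + 1) * ((p + d * 10 + 2 * (2 * d + 1)) *
      (p + d * 10 + 2 * (2 * d + 1) + 1)) : ℕ) : ℝ) ≤
      (𝔠 + 5) * (𝔠 + 17) ^ 2 * (d : ℝ) ^ (16 + 8 * 𝔡) * (N : ℝ) ^ 6 * (1 + l ^ 2) := by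
  have hd1 : (1 : ℝ) ≤ d := by exact_mod_cast hd
  have hN1 : (1 : ℝ) ≤ N := by exact_mod_cast hN
  have hHp : (H : ℝ) ≤ p := by exact_mod_cast hH
  have hD1 : 1 ≤ (d : ℝ) ^ 𝔡 := Real.one_le_rpow hd1 h𝔡.le
  have hpow : (d : ℝ) ^ 2 * ((d : ℝ) ^ 𝔡) ^ 3 ≤ (d : ℝ) ^ (16 + 8 * 𝔡) := by
    rw [← Real.rpow_natCast, ← Real.rpow_natCast, ← Real.rpow_mul (by positivity),
      ← Real.rpow_add (by positivity)]
    refine Real.rpow_le_rpow_of_exponent_le hd1 ?_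
    push_cast
    linarith
  set D := (d : ℝ) ^ 𝔡
  have hdD : (d : ℝ) ≤ d * D := le_mul_of_one_le_right (by positivity) hD1
  have hDd : D ≤ d * D := le_mul_of_one_le_left (by positivity) hd1
  have hpd : (p : ℝ) ≤ 𝔠 * (d * D) := hp.trans (by gcongr)
  have hW : (p : ℝ) + d * 10 + 2 * (2 * d + 1) + 1 ≤ (𝔠 + 17) * (d * D) := by nlinarith
  have hh : (N : ℝ) * (H + (m + 2)) + 1 ≤ (𝔠 + 5) * (N * D * (1 + l ^ 2)) := by
    have h1 : (H : ℝ) + (m + 2) + 1 ≤ (𝔠 + 5) * (D * (1 + l ^ 2)) := by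
      have h2 : D ≤ D * (1 + l ^ 2) := le_mul_of_one_le_right (by positivity) (by nlinarith)
      have h3 : 1 + l ^ 2 ≤ D * (1 + l ^ 2) := le_mul_of_one_le_left (by positivity) hD1
      nlinarith [sq_nonneg (l - 1)]
    calc (N : ℝ) * (H + (m + 2)) + 1 ≤ N * (H + (m + 2) + 1) := by linarith
      _ ≤ N * ((𝔠 + 5) * (D * (1 + l ^ 2))) := by gcongr
      _ = _ := by ring
  push_cast
  calc ((N : ℝ) * (H + (m + 2)) + 1) * ((p + d * 10 + 2 * (2 * d + 1)) *
        (p + d * 10 + 2 * (2 * d + 1) + 1))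
      ≤ ((𝔠 + 5) * (N * D * (1 + l ^ 2))) * (((𝔠 + 17) * (d * D)) * ((𝔠 + 17) * (d * D))) := by
        gcongr
        linarith
    _ = (𝔠 + 5) * (𝔠 + 17) ^ 2 * ((d : ℝ) ^ 2 * D ^ 3) * N * (1 + l ^ 2) := by ring
    _ ≤ (𝔠 + 5) * (𝔠 + 17) ^ 2 * (d : ℝ) ^ (16 + 8 * 𝔡) * (N : ℝ) ^ 6 * (1 + l ^ 2) := by
        gcongr
        exact le_self_pow₀ hN1 (by norm_num)

/-- The extension by zero of a finite family of vectors to a sequence. -/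
def extendZero {d N : ℕ} (y : RVecs d N) (k : ℕ) : RVec d :=
  if h : k < N then y ⟨k, h⟩ else 0

theorem sum_norm_extendZero_sq {d N : ℕ} (y : RVecs d N) :
    ∑ k ∈ Finset.range N, ‖extendZero y k‖ ^ 2 = ‖y‖ ^ 2 := by
  rw [PiLp.norm_sq_eq_of_L2, ← Fin.sum_univ_eq_sum_range (fun k => ‖extendZero y k‖ ^ 2)]
  simp [extendZero]

theorem continuous_extendZero {d N : ℕ} :
    Continuous (extendZero : RVecs d N → ℕ → RVec d) := by
  refine continuous_pi fun k => ?_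
  unfold extendZero
  split_ifs <;> fun_prop

end

/-! ### Assembly of the estimates -/

theorem mainTheorem3
    (𝔠 T 𝔡 : ℝ) (h𝔠 : 0 < 𝔠) (hT : 0 < T) (h𝔡 : 0 < 𝔡)
    (a : C(ℝ, ℝ)) (ha : ∀ x : ℝ, a x = max x 0)
    (Φ : (d : ℕ+) → ANN (d : ℕ) (d : ℕ))
    (hΦ_growth : ∀ (d : ℕ+) (x : RVec d), ‖(Φ d).realize a x‖ ≤ 𝔠 * (1 + ‖x‖))
    (hΦ_size : ∀ d : ℕ+, ((Φ d).paramCount : ℝ) ≤ 𝔠 * (d : ℝ) ^ 𝔡)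
    (Y : (d N : ℕ+) → Set.Icc (0 : ℝ) T → RVec d → RVecs d N → RVec d)
    (hY_zero : ∀ (d N : ℕ+) (x : RVec d) (y : RVecs d N) (t : Set.Icc (0 : ℝ) T),
      (t : ℝ) = 0 → Y d N t x y = x)
    (hY_step : ∀ (d N : ℕ+) (n : Fin (N : ℕ)) (s t : Set.Icc (0 : ℝ) T)
      (x : RVec d) (y : RVecs d N),
      (s : ℝ) = (n : ℝ) * T / (N : ℝ) →
      (t : ℝ) ∈ Set.Icc ((n : ℝ) * T / (N : ℝ)) (((n : ℝ) + 1) * T / (N : ℝ)) →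
      Y d N t x y = Y d N s x y +
        ((t : ℝ) * (N : ℝ) / T - (n : ℝ)) •
          ((T / (N : ℝ)) • (Φ d).realize a (Y d N s x y) + y n)) :
    ∃ (C : ℝ) (Ψ : Set.Ioc (0 : ℝ) 1 → (d N : ℕ+) → RVecs d N → ANN ((d : ℕ) + 1) (d : ℕ)),
      (∀ (ε : Set.Ioc (0 : ℝ) 1) (d N : ℕ+) (y : RVecs d N),
        Continuous ((Ψ ε d N y).realize a)) ∧
      (∀ (ε : Set.Ioc (0 : ℝ) 1) (d N : ℕ+) (t : Set.Icc (0 : ℝ) T)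
        (x : RVec d) (y : RVecs d N),
        ‖Y d N t x y - (Ψ ε d N y).realize a (timeSpace (t : ℝ) x)‖ ≤
          C * (d : ℝ) ^ (1 / 2 : ℝ) * (N : ℝ) ^ (3 / 2 : ℝ) * (ε : ℝ) *
            (1 + ‖x‖ ^ 3 + ‖y‖ ^ 3)) ∧
      (∀ (ε : Set.Ioc (0 : ℝ) 1) (d N : ℕ+) (t : Set.Icc (0 : ℝ) T)
        (x : RVec d) (y : RVecs d N),
        ‖(Ψ ε d N y).realize a (timeSpace (t : ℝ) x)‖ ≤
          C * (d : ℝ) ^ (1 / 2 : ℝ) * (N : ℝ) * (1 + ‖x‖ ^ 2 + ‖y‖ ^ 2)) ∧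
      (∀ (ε : Set.Ioc (0 : ℝ) 1) (d N : ℕ+) (y : RVecs d N),
        ((Ψ ε d N y).paramCount : ℝ) ≤
          C * (d : ℝ) ^ (16 + 8 * 𝔡) * (N : ℝ) ^ 6 * (1 + |Real.log (ε : ℝ)| ^ 2)) ∧
      (∀ (ε : Set.Ioc (0 : ℝ) 1) (d N : ℕ+) (t : Set.Icc (0 : ℝ) T) (x : RVec d),
        Continuous (fun y : RVecs d N => (Ψ ε d N y).realize a (timeSpace (t : ℝ) x))) ∧
      (∀ (ε : Set.Ioc (0 : ℝ) 1) (d N : ℕ+) (n : ℕ), n ≤ (N : ℕ) →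
        ∀ (t : Set.Icc (0 : ℝ) T), (t : ℝ) ≤ (n : ℝ) * T / (N : ℝ) →
        ∀ (x : RVec d) (y z : RVecs d N), (∀ k : Fin (N : ℕ), (k : ℕ) < n → y k = z k) →
          (Ψ ε d N y).realize a (timeSpace (t : ℝ) x) =
            (Ψ ε d N z).realize a (timeSpace (t : ℝ) x)) := by
  -- The constant of `sum_norm_eulerIncr_sq_le` with `N * τ = T`.
  set K := 6 * (𝔠 * T) ^ 2 * Real.exp (𝔠 * T) ^ 2 + 2
  have hK : 0 ≤ K := by positivity
  let f (d : ℕ+) : RVec d → RVec d := (Φ d).realize a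
  have hm (ε : Set.Ioc (0 : ℝ) 1) := exists_inv_four_pow_le_sq ε.2.1 ε.2.2
  choose m hm4 hml using hm
  have hnet : ∀ (ε : Set.Ioc (0 : ℝ) 1) (d N : ℕ+) (y : RVecs d N),
      ∃ Ψ : ANN ((d : ℕ) + 1) (d : ℕ),
        (∀ z, Ψ.realize a z = eulerInterp (prodApprox (m ε) (ε : ℝ)⁻¹) (T / N) (f d)
          (extendZero y) N (z 0) (WithLp.toLp 2 fun i => z i.succ)) ∧
        (Ψ.paramCount : ℝ) ≤ (𝔠 + 5) * (𝔠 + 17) ^ 2 * (d : ℝ) ^ (16 + 8 * 𝔡) * (N : ℝ) ^ 6 *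
          (1 + |Real.log (ε : ℝ)| ^ 2) := by
    intro ε d N y
    obtain ⟨H, hH, hf⟩ := (Φ d).exists_isReluNet_realize ha
    obtain ⟨Ψ, hΨ, hcount⟩ := ANN.exists_realize_eq ha (Nat.succ_pos _) d.pos (by omega)
      (by omega) (isReluNet_eulerInterp d.pos hf (IsReluNet.prodApprox (m ε) (ε : ℝ)⁻¹) (T / N)
        (extendZero y) N)
    exact ⟨Ψ, hΨ, (Nat.cast_le.2 hcount).trans (paramCount_bound h𝔠 h𝔡 d.pos
      N.pos (hΦ_size d) hH (hml ε))⟩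
  choose Ψ hΨ hcount using hnet
  have hts : ∀ ε (d N : ℕ+) (y : RVecs d N) (t : ℝ) (x : RVec d),
      (Ψ ε d N y).realize a (timeSpace t x) = eulerInterp (prodApprox (m ε) (ε : ℝ)⁻¹) (T / N)
        (f d) (extendZero y) N t x := fun ε d N y t x => by rw [hΨ]; rfl
  have hYeq : ∀ (d N : ℕ+) (t : Set.Icc (0 : ℝ) T) (x : RVec d) (y : RVecs d N),
      Y d N t x y = eulerInterp (fun u v => clipUnit u * v) (T / N) (f d) (extendZero y) N t x := by
    intro d N t x y
    refine eq_eulerInterp hT N.pos (f d) (extendZero y) x (fun t => Y d N t x y)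
      (fun t ht => hY_zero d N x y t ht) (fun n s t hn hs ht => ?_) t
    simpa [extendZero, hn] using hY_step d N ⟨n, hn⟩ s t x y hs ht
  have hincr : ∀ (d N : ℕ+) (x : RVec d) (y : RVecs d N),
      ∑ k ∈ Finset.range N, ‖eulerIncr (T / N) (f d) (extendZero y) x k‖ ^ 2 ≤
        K * (1 + ‖x‖ ^ 2 + ‖y‖ ^ 2) := by
    intro d N x y
    have h := sum_norm_eulerIncr_sq_le h𝔠.le (by positivity : 0 ≤ T / (N : ℝ)) (hΦ_growth d)
      (extendZero y) x (sum_norm_extendZero_sq y)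
    rwa [mul_div_cancel₀ T (by simp : ((N : ℕ) : ℝ) ≠ 0)] at h
  have herr : ∀ (ε : Set.Ioc (0 : ℝ) 1) (d N : ℕ+) (t : Set.Icc (0 : ℝ) T) (x : RVec d)
      (y : RVecs d N), ‖Y d N t x y - (Ψ ε d N y).realize a (timeSpace (t : ℝ) x)‖ ≤
        ε * (N * √d + K * (1 + ‖x‖ ^ 2 + ‖y‖ ^ 2)) := by
    intro ε d N t x y
    rw [hYeq, hts]
    refine (norm_eulerInterp_sub_le ε.2.1.le (abs_sub_prodApprox_le ε.2.1 (hm4 ε)) _ _ _ _ _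
      _).trans ?_
    have := ε.2.1
    gcongr
    exact hincr d N x y
  have hd1 (d : ℕ+) : 1 ≤ √(d : ℝ) := Real.one_le_sqrt.2 (by exact_mod_cast d.pos)
  have hN1 (N : ℕ+) : (1 : ℝ) ≤ N := by exact_mod_cast N.pos
  have hscale : ∀ (d N : ℕ+) (U : ℝ), 1 ≤ U →
      N * √(d : ℝ) + K * U ≤ (1 + K) * √(d : ℝ) * N * U := by
    intro d N U hU
    have h1 : 1 ≤ N * √(d : ℝ) := one_le_mul_of_one_le_of_one_le (hN1 N) (hd1 d)
    have h2 : N * √(d : ℝ) ≤ N * √(d : ℝ) * U := le_mul_of_one_le_right (by positivity) hU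
    have h3 : K * U ≤ N * √(d : ℝ) * (K * U) := le_mul_of_one_le_left (by positivity) h1
    linarith
  -- The first summand serves the error (the 3 comes from replacing squares by cubes) and the growth
  -- bound, where `1 + 2 * (1 + K) ≤ 3 * (1 + K)`; the second serves the parameter count.
  refine ⟨3 * (1 + K) + (𝔠 + 5) * (𝔠 + 17) ^ 2, Ψ,
    fun ε d N y => ANN.continuous_realize a.continuous _, ?_, ?_, ?_, ?_, ?_⟩
  · intro ε d N t x y
    have hε := ε.2.1
    refine (herr ε d N t x y).trans ?_
    have hU : 1 ≤ 1 + ‖x‖ ^ 2 + ‖y‖ ^ 2 := by nlinarith [sq_nonneg ‖x‖, sq_nonneg ‖y‖]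
    have hcube (z : ℝ) (hz : 0 ≤ z) : z ^ 2 ≤ 1 + z ^ 3 := by
      nlinarith [mul_nonneg hz (sq_nonneg (z - 1))]
    have hU3 : 1 + ‖x‖ ^ 2 + ‖y‖ ^ 2 ≤ 3 * (1 + ‖x‖ ^ 3 + ‖y‖ ^ 3) := by
      have hx := hcube ‖x‖ (norm_nonneg _)
      have hy := hcube ‖y‖ (norm_nonneg _)
      have : 0 ≤ ‖x‖ ^ 3 := by positivity
      have : 0 ≤ ‖y‖ ^ 3 := by positivity
      linarith
    have hN32 : (N : ℝ) ≤ (N : ℝ) ^ (3 / 2 : ℝ) :=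
      Real.self_le_rpow_of_one_le (hN1 N) (by norm_num)
    rw [← Real.sqrt_eq_rpow]
    calc (ε : ℝ) * (N * √(d : ℝ) + K * (1 + ‖x‖ ^ 2 + ‖y‖ ^ 2))
        ≤ ε * ((1 + K) * √(d : ℝ) * (N : ℝ) ^ (3 / 2 : ℝ) * (3 * (1 + ‖x‖ ^ 3 + ‖y‖ ^ 3))) := by
          gcongr
          refine (hscale d N _ hU).trans ?_
          gcongr
      _ = (3 * (1 + K)) * √(d : ℝ) * (N : ℝ) ^ (3 / 2 : ℝ) * ε * (1 + ‖x‖ ^ 3 + ‖y‖ ^ 3) := by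
          ring
      _ ≤ _ := by
          gcongr
          exact le_add_of_nonneg_right (by positivity)
  · intro ε d N t x y
    have hU : 1 ≤ 1 + ‖x‖ ^ 2 + ‖y‖ ^ 2 := by nlinarith [sq_nonneg ‖x‖, sq_nonneg ‖y‖]
    have hxU : ‖x‖ ≤ 1 + ‖x‖ ^ 2 + ‖y‖ ^ 2 := by
      nlinarith [sq_nonneg (‖x‖ - 1), sq_nonneg ‖x‖, sq_nonneg ‖y‖]
    have h1 := herr ε d N t x y
    have h2 : ‖Y d N t x y‖ ≤ ‖x‖ + (N + K * (1 + ‖x‖ ^ 2 + ‖y‖ ^ 2)) := by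
      rw [hYeq]
      refine (norm_eulerInterp_le _ _ _ _ _ _).trans ?_
      gcongr
      exact hincr d N x y
    generalize hUdef : 1 + ‖x‖ ^ 2 + ‖y‖ ^ 2 = U at *
    have h3 := norm_sub_le (Y d N t x y) (Y d N t x y - (Ψ ε d N y).realize a (timeSpace t x))
    rw [sub_sub_cancel] at h3
    have h4 : (ε : ℝ) * (N * √(d : ℝ) + K * U) ≤ N * √(d : ℝ) + K * U :=
      mul_le_of_le_one_left (by positivity) ε.2.2
    have h5 : (N : ℝ) ≤ N * √(d : ℝ) := le_mul_of_one_le_right (by positivity) (hd1 d)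
    have h6 : U ≤ √(d : ℝ) * N * U := le_mul_of_one_le_left (by positivity)
      (one_le_mul_of_one_le_of_one_le (hd1 d) (hN1 N))
    have h7 := hscale d N U hU
    have h8 : 0 ≤ K * (√(d : ℝ) * N * U) := by positivity
    rw [← Real.sqrt_eq_rpow]
    calc ‖(Ψ ε d N y).realize a (timeSpace t x)‖ ≤ (3 * (1 + K)) * √(d : ℝ) * N * U := by
          linarith
      _ ≤ _ := by
          gcongr
          exact le_add_of_nonneg_right (by positivity)
  · intro ε d N y
    refine (hcount ε d N y).trans ?_
    gcongr
    exact le_add_of_nonneg_left (by positivity)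
  · intro ε d N t x
    -- The network varies with `y`, but its realization has a closed form from which continuity in
    -- `y` is read off.
    simp only [hts]
    exact (continuous_eulerInterp (continuous_prodApprox _ _) _
      (ANN.continuous_realize a.continuous _) _ _ _).comp continuous_extendZero
  · intro ε d N n hn t ht x y z hyz
    rw [hts, hts]
    refine eulerInterp_congr (fun u hu v => prodApprox_of_nonpos _ _ hu v) (by positivity) _
      (n := n) (fun k hk => ?_) _ (ht.trans_eq (by ring)) x
    have hkN : k < N := by omega
    simpa [extendZero, hkN] using hyz ⟨k, hkN⟩ hk
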